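/- For $n\ge 1$ let $\rho_n$ be the point of the Euclidean plane $\mathbb{R}^2$ with polar coordinates $(r,\alpha)=(2^{-n},2^{-n})$, and let $S_n$ be the set of points with polar coordinates $(r,\alpha)$, $0\le r<2^{-n}$, $|\alpha-2^{-n}|<2^{-n-2}$. There are arcs $L_n$ ($n\ge1$) such that each $L_n$ consists of finitely many line segments, has no self-intersections, goes from the origin to $\rho_n$, has total length exactly $2^n$, and satisfies $L_n\subset S_n\cup\{\rho_n\}$. For every such choice of arcs, the set $P=\bigcup_{n\ge1}L_n\subset\mathbb{R}^2$ has the following properties. 1. $P$ is a dendrite, that is, a Peano continuum (a nonempty compact, connected, locally connected metrizable space) containing no simple closed curve. 2. $P$ is a Banach fractal: it is compact metrizable and homeomorphic to the attractor of an IFS on some complete metric space. 3. $P$, with the Euclidean metric, is not the attractor of any weak IFS, neither on $\mathbb{R}^2$ nor on any other metric space $X$ that contains $P$ isometrically (for instance $X=P$). Here an IFS (respectively a weak IFS) on a metric space $(X,d)$ is a finite family $\mathcal F$ of self-maps of $X$ each of which is Lipschitz with a constant less than $1$ (respectively satisfies $d(f(x),f(y))<d(x,y)$ for all $x\ne y$),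 and an attractor of $\mathcal F$ is a nonempty compact set $A\subset X$ with $A=\bigcup_{f\in\mathcal F}f(A)$. -/

import Mathlib

open Set
open scoped ENNReal NNReal

universe u

/-- A (classical) IFS on a metric space: a finite family of self-maps, each Lipschitz with a
constant smaller than `1`. -/
def IsIFS {X : Type u} [MetricSpace X] (F : Set (X → X)) : Prop :=
  F.Finite ∧ ∀ f ∈ F, ∃ k : ℝ≥0, k < 1 ∧ LipschitzWith k f

/-- A weak IFS on a metric space: a finite family of self-maps, each strictly decreasing the
distance between distinct points. -/
def IsWeakIFS {X : Type u} [MetricSpace X] (F : Set (X → X)) : Prop :=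
  F.Finite ∧ ∀ f ∈ F, ∀ x y : X, x ≠ y → dist (f x) (f y) < dist x y

/-- `A` is an attractor of the family `F`: a nonempty compact set which is the union of its images.
For an IFS or a weak IFS such a set is automatically unique. -/
def IsAttractorOf {X : Type u} [MetricSpace X] (F : Set (X → X)) (A : Set X) : Prop :=
  A.Nonempty ∧ IsCompact A ∧ A = ⋃ f ∈ F, f '' A

/-- `A` is an IFS-attractor in the metric space `X`. -/
def IsIFSAttractor {X : Type u} [MetricSpace X] (A : Set X) : Prop :=
  ∃ F : Set (X → X), IsIFS F ∧ IsAttractorOf F A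

/-- `A` is a weak IFS-attractor in the metric space `X`. -/
def IsWeakIFSAttractor {X : Type u} [MetricSpace X] (A : Set X) : Prop :=
  ∃ F : Set (X → X), IsWeakIFS F ∧ IsAttractorOf F A

/-- A Banach fractal: a compact metrizable space homeomorphic to the attractor of an IFS on a
complete metric space. -/
def IsBanachFractal (X : Type u) [TopologicalSpace X] : Prop :=
  CompactSpace X ∧ TopologicalSpace.MetrizableSpace X ∧
    ∃ (Y : Type u) (_ : MetricSpace Y) (_ : CompleteSpace Y) (K : Set Y),
      IsIFSAttractor K ∧ Nonempty (X ≃ₜ K)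

/-- A Peano continuum: a (nonempty) compact connected locally connected metrizable space. -/
def IsPeanoContinuum (X : Type u) [TopologicalSpace X] : Prop :=
  CompactSpace X ∧ TopologicalSpace.MetrizableSpace X ∧ ConnectedSpace X ∧ LocallyConnectedSpace X

/-- A dendrite: a Peano continuum that contains no simple closed curve. -/
def IsDendrite (X : Type u) [TopologicalSpace X] : Prop :=
  IsPeanoContinuum X ∧ ∀ γ : Circle → X, Continuous γ → ¬ Function.Injective γ

/-- The Euclidean plane. -/
abbrev Plane : Type := EuclideanSpace ℝ (Fin 2)

/-- The point of the plane with polar coordinates `(r, α)`. -/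
noncomputable def polarPoint (r α : ℝ) : Plane :=
  !₂[r * Real.cos α, r * Real.sin α]

/-- `A` is an arc with endpoints `a` and `b` (without self-intersections) that consists of finitely
many line segments and whose length is `ℓ`. The arc is parametrized by an embedding `e` of `[0, 1]`
that is affine on each interval `[t i, t (i + 1)]` of a partition; the length is the supremum of
`∑ d (e (x (i - 1)), e (x i))` over all partitions of `[0, 1]`, which is `eVariationOn`. -/
def IsPolygonalArc (A : Set Plane) (a b : Plane) (ℓ : ℝ≥0∞) : Prop :=
  ∃ e : ℝ → Plane,
    ContinuousOn e (Icc 0 1) ∧ InjOn e (Icc 0 1) ∧ e '' Icc 0 1 = A ∧ e 0 = a ∧ e 1 = b ∧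
    (∃ (N : ℕ) (t : ℕ → ℝ), t 0 = 0 ∧ t N = 1 ∧ (∀ i < N, t i < t (i + 1)) ∧
      ∀ i < N, ∀ s ∈ Icc (0 : ℝ) 1,
        e (AffineMap.lineMap (t i) (t (i + 1)) s) =
          AffineMap.lineMap (e (t i)) (e (t (i + 1))) s) ∧
    eVariationOn e (Icc 0 1) = ℓ

/-- The point `ρ_n` with polar coordinates `(2 ^ (-n), 2 ^ (-n))`. -/
noncomputable def tipPoint (n : ℕ) : Plane :=
  polarPoint ((1 / 2 : ℝ) ^ n) ((1 / 2 : ℝ) ^ n)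

/-- The open-angled sector, in polar coordinates
`[0, 2 ^ (-n)) × (2 ^ (-n) - 2 ^ (-n - 2), 2 ^ (-n) + 2 ^ (-n - 2))`. -/
noncomputable def sector (n : ℕ) : Set Plane :=
  {x | ∃ r α : ℝ, 0 ≤ r ∧ r < (1 / 2 : ℝ) ^ n ∧
    (1 / 2 : ℝ) ^ n - (1 / 2 : ℝ) ^ (n + 2) < α ∧
    α < (1 / 2 : ℝ) ^ n + (1 / 2 : ℝ) ^ (n + 2) ∧ x = polarPoint r α}

/-- For every `n ≥ 1`, the set `L n` is a polygonal arc of length `2 ^ n` from the origin to `ρ_n`,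
contained in the `n`-th sector except for its endpoint `ρ_n`. (The set `L 0` plays no role.) -/
def IsArmFamily (L : ℕ → Set Plane) : Prop :=
  ∀ n : ℕ, 1 ≤ n →
    IsPolygonalArc (L n) 0 (tipPoint n) (2 ^ n) ∧ L n ⊆ sector n ∪ {tipPoint n}

/-- The union of the arcs `L n`, `n ≥ 1`. -/
def armUnion (L : ℕ → Set Plane) : Set Plane :=
  ⋃ (n : ℕ) (_ : 1 ≤ n), L n

/-! The set P is a star: countably many arcs issue from the origin, otherwise disjoint, with
diameters tending to 0. As a topological space it is therefore the compact model `spikes`, whatever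
the lengths of the arcs; this gives the dendrite properties. The same model with straight arms of
length 2⁻ᵏ in the bounded sequences is the attractor of an IFS, so P is a Banach fractal.

The lengths obstruct weak IFSs. Let f be a strict contraction of P into itself, and let the tip of
arm n be f(x) with x on arm m. The image of the arc from 0 to x joins f(0) to that tip and is no
longer than arm m. If f(0) is not on arm n away from the centre, this image must run along the whole
of arm n, and as lengths increase, n ≤ m. So |x| is at most the norm of tip n. If f(0) = 0,
strictness makes the norm of tip n smaller than |x|, a contradiction: no tip is covered. If f(0) ≠
0, tip n lies within |x| of f(0) while both |x| and the norm of tip n tend to 0 with n: only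
finitely many tips are covered (`IsArmSystem.finite_setOf_end_mem_image`). Finitely many maps cannot
cover all the tips.

Arms with the prescribed lengths exist because a fine zigzag fits into any sector (`exists_arm`). -/

open Filter Topology

/-! ### Topology of the model star. -/

/-- The model of a star with countably many spikes: the points of the Hilbert cube with at most one
nonzero coordinate. -/
def spikes : Set (ℕ → ℝ) :=
  {z | (∀ k, z k ∈ Icc (0 : ℝ) 1) ∧ ∀ k l, k ≠ l → z k * z l = 0}

lemma single_mem_spikes {k : ℕ} {t : ℝ} (ht : t ∈ Icc (0 : ℝ) 1) : Pi.single k t ∈ spikes := by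
  refine ⟨fun l => ?_, fun l m hlm => ?_⟩
  · by_cases h : l = k
    · subst h; simpa using ht
    · simp [h]
  · by_cases h : l = k
    · subst h; simp [Ne.symm hlm]
    · simp [h]

lemma zero_mem_spikes : (0 : ℕ → ℝ) ∈ spikes := by
  simpa using single_mem_spikes (k := 0) (t := 0) (by simp)

lemma eq_single_of_mem_spikes {z : ℕ → ℝ} (hz : z ∈ spikes) {k : ℕ} (hk : z k ≠ 0) :
    z = Pi.single k (z k) := by
  ext l
  by_cases h : l = k
  · subst h; simp
  · simpa [h, hk] using hz.2 l k h

lemma exists_eq_single_of_mem_spikes {z : ℕ → ℝ} (hz : z ∈ spikes) :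
    ∃ k, z = Pi.single k (z k) := by
  by_cases h : ∃ k, z k ≠ 0
  · obtain ⟨k, hk⟩ := h
    exact ⟨k, eq_single_of_mem_spikes hz hk⟩
  · push Not at h
    refine ⟨0, ?_⟩
    rw [h 0, Pi.single_zero]
    exact funext h

lemma isCompact_spikes : IsCompact spikes := by
  have h1 : IsCompact (univ.pi fun _ : ℕ => Icc (0 : ℝ) 1) :=
    isCompact_univ_pi fun _ => isCompact_Icc
  refine h1.of_isClosed_subset ?_ fun z hz k _ => hz.1 k
  have : spikes = (univ.pi fun _ : ℕ => Icc (0 : ℝ) 1) ∩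
      ⋂ (k : ℕ) (l : ℕ) (_ : k ≠ l), {z : ℕ → ℝ | z k * z l = 0} := by
    ext z
    simp only [spikes, mem_inter_iff, Set.mem_pi, mem_univ, mem_iInter, mem_ofPred_eq,
      forall_true_left]
  rw [this]
  refine h1.isClosed.inter ?_
  refine isClosed_iInter fun k => isClosed_iInter fun l => isClosed_iInter fun _ => ?_
  exact isClosed_eq ((continuous_apply k).mul (continuous_apply l)) continuous_const

lemma smul_add_smul_single_mem_spikes {k : ℕ} {s t a b : ℝ} (hs : s ∈ Icc (0 : ℝ) 1)
    (ht : t ∈ Icc (0 : ℝ) 1) (ha : 0 ≤ a) (hb : 0 ≤ b) (hab : a + b = 1) :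
    a • (Pi.single k s : ℕ → ℝ) + b • Pi.single k t ∈ spikes := by
  rw [← Pi.single_smul, ← Pi.single_smul, ← Pi.single_add]
  exact single_mem_spikes (convex_Icc (0 : ℝ) 1 hs ht ha hb hab)

lemma starConvex_spikes : StarConvex ℝ (0 : ℕ → ℝ) spikes := by
  intro z hz a b ha hb hab
  obtain ⟨k, hk⟩ := exists_eq_single_of_mem_spikes hz
  have := smul_add_smul_single_mem_spikes (k := k) (s := 0) (t := z k) (by simp) (hz.1 k) ha hb hab
  rwa [← hk, Pi.single_zero] at this

instance : CompactSpace spikes := isCompact_iff_compactSpace.1 isCompact_spikes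

instance : ConnectedSpace spikes :=
  isConnected_iff_connectedSpace.1
    (starConvex_spikes.isPathConnected zero_mem_spikes).isConnected

/-- A convex neighbourhood of the centre cuts out a set star-shaped about 0. At a point with nonzero
coordinate `k`, a convex neighbourhood on which that coordinate stays nonzero meets the `k`-th spike
only, in a convex set. -/
instance : LocallyConnectedSpace spikes := by
  rw [locallyConnectedSpace_iff_connected_subsets]
  rintro ⟨z, hz⟩ U hU
  obtain ⟨W, hW, hWU⟩ := mem_nhds_subtype _ _ _ |>.1 hU
  suffices H : ∃ W' ∈ 𝓝 z, W' ⊆ W ∧ StarConvex ℝ z (spikes ∩ W') by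
    obtain ⟨W', hW', hsub, hstar⟩ := H
    refine ⟨(↑) ⁻¹' W', continuousAt_subtype_val.preimage_mem_nhds hW', ?_, (preimage_mono hsub).trans hWU⟩
    rw [← IsInducing.subtypeVal.isPreconnected_image, Subtype.image_preimage_coe]
    exact (hstar.isPathConnected ⟨hz, mem_of_mem_nhds hW'⟩).isConnected.isPreconnected
  have key := (locallyConvexSpace_iff_exists_convex_subset ℝ (ℕ → ℝ)).1 inferInstance z
  by_cases h0 : z = 0
  · obtain ⟨W', hW', hconv, hsub⟩ := key W hW
    refine ⟨W', hW', hsub, ?_⟩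
    subst h0
    exact starConvex_spikes.inter (hconv.starConvex (mem_of_mem_nhds hW'))
  · obtain ⟨k, hk⟩ := Function.ne_iff.1 h0
    have hopen : {w : ℕ → ℝ | w k ≠ 0} ∈ 𝓝 z :=
      (isOpen_ne_fun (continuous_apply k) continuous_const).mem_nhds hk
    obtain ⟨W', hW', hconv, hsub⟩ := key _ (inter_mem hW hopen)
    refine ⟨W', hW', hsub.trans inter_subset_left, ?_⟩
    rintro w ⟨hw, hwW⟩ a b ha hb hab
    refine ⟨?_, hconv (mem_of_mem_nhds hW') hwW ha hb hab⟩
    have hwk : w k ≠ 0 := (hsub hwW).2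
    rw [eq_single_of_mem_spikes hz hk, eq_single_of_mem_spikes hw hwk]
    exact smul_add_smul_single_mem_spikes (hz.1 k) (hw.1 k) ha hb hab

/-- A positive value of coordinate `k` determines the point of the star. Along the circle this
coordinate is a continuous periodic function, so a value strictly between those at two opposite
points is attained on both half-turns. -/
lemma not_injective_circle_spikes (γ : Circle → spikes) (hγ : Continuous γ) :
    ¬ Function.Injective γ := by
  intro hinj
  have hpi := Real.pi_pos
  obtain ⟨k, θ, hk⟩ : ∃ (k : ℕ) (θ : ℝ), (γ (Circle.exp θ) : ℕ → ℝ) k ≠ 0 := by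
    by_contra! H
    have h : Circle.exp 0 = Circle.exp Real.pi := by
      apply hinj
      ext k
      rw [H, H]
    obtain ⟨m, hm⟩ := Circle.exp_eq_exp.1 h
    have h1 : ((1 + 2 * m : ℤ) : ℝ) * Real.pi = 0 := by push_cast; linarith
    rcases mul_eq_zero.1 h1 with h2 | h2
    · have : (1 + 2 * m : ℤ) = 0 := by exact_mod_cast h2
      omega
    · exact hpi.ne' h2
  set c : ℝ → ℝ := fun θ => (γ (Circle.exp θ) : ℕ → ℝ) k with hc
  have hcont : Continuous c :=
    (continuous_apply k).comp (continuous_subtype_val.comp (hγ.comp Circle.exp.continuous))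
  have hnonneg : ∀ θ, 0 ≤ c θ := fun θ => ((γ (Circle.exp θ)).2.1 k).1
  have hc2 : c (θ + 2 * Real.pi) = c θ := by
    simp only [hc]
    rw [show Circle.exp (θ + 2 * Real.pi) = Circle.exp θ from
      Circle.exp_eq_exp.2 ⟨1, by simp⟩]
  have hsep : ∀ x y, c x = c y → c x ≠ 0 → x < y → y < x + 2 * Real.pi → False := by
    intro x y hxy hx hlt hlt'
    have h : Circle.exp y = Circle.exp x := by
      apply hinj
      apply Subtype.ext
      rw [eq_single_of_mem_spikes (γ (Circle.exp x)).2 hx,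
        eq_single_of_mem_spikes (γ (Circle.exp y)).2 (k := k) (by
          change c y ≠ 0; rwa [← hxy])]
      exact congrArg _ hxy.symm
    obtain ⟨m, hm⟩ := Circle.exp_eq_exp.1 h
    have h1 : (0 : ℝ) < m := by nlinarith
    have h2 : (m : ℝ) < 1 := by nlinarith
    have h1' : 0 < m := by exact_mod_cast h1
    have h2' : m < 1 := by exact_mod_cast h2
    omega
  have hne : c θ ≠ c (θ + Real.pi) := fun h =>
    hsep _ _ h hk (by linarith) (by linarith)
  obtain ⟨t, ht⟩ : ∃ t, t ∈ Ioo (min (c θ) (c (θ + Real.pi))) (max (c θ) (c (θ + Real.pi))) :=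
    exists_between (min_lt_max.2 hne)
  have ht0 : t ≠ 0 := ((le_min (hnonneg _) (hnonneg _)).trans_lt ht.1).ne'
  have ht1 : t ∈ uIcc (c θ) (c (θ + Real.pi)) := Ioo_subset_Icc_self ht
  have ht2 : t ∈ uIcc (c (θ + Real.pi)) (c (θ + 2 * Real.pi)) := by rwa [hc2, uIcc_comm]
  obtain ⟨x, hx, hxt⟩ := intermediate_value_uIcc hcont.continuousOn ht1
  obtain ⟨y, hy, hyt⟩ := intermediate_value_uIcc hcont.continuousOn ht2
  rw [uIcc_of_le (by linarith)] at hx hy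
  have hxne : x ≠ θ + Real.pi := by
    rintro rfl
    rcases min_lt_max.2 hne with _
    rw [hxt] at ht
    rcases le_total (c θ) t with h | h
    · simp [h] at ht
    · simp [h] at ht
  have hyne : y ≠ θ + 2 * Real.pi := by
    rintro rfl
    rw [← hc2, hyt] at ht
    rcases le_total t (c (θ + Real.pi)) with h | h
    · simp [h] at ht
    · simp [h] at ht
  have hx' : x < θ + Real.pi := lt_of_le_of_ne hx.2 hxne
  have hy' : y < θ + 2 * Real.pi := lt_of_le_of_ne hy.2 hyne
  exact hsep x y (hxt.trans hyt.symm) (hxt ▸ ht0) (by linarith [hy.1]) (by linarith [hx.1])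

/-! ### Embedded stars and their homeomorphism with the model. -/

/-- A sequence of arcs of diameters tending to `0`, issuing from the origin and disjoint otherwise,
parametrized by maps of the real line that are injective on the unit interval. -/
structure IsArmSystem {V : Type*} [NormedAddCommGroup V] (E : ℕ → ℝ → V) : Prop where
  continuous : ∀ k, Continuous (E k)
  zero : ∀ k, E k 0 = 0
  norm_le : ∀ k s, ‖E k s‖ ≤ (1 / 2 : ℝ) ^ k
  injOn : ∀ k, InjOn (E k) (Icc 0 1)
  eq_zero : ∀ k l, k ≠ l → ∀ s ∈ Icc (0 : ℝ) 1, ∀ t ∈ Icc (0 : ℝ) 1, E k s = E l t → s = 0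

/-- The map that sends the `k`-th spike to the `k`-th arc. -/
noncomputable def starMap {V : Type*} [NormedAddCommGroup V] (E : ℕ → ℝ → V) (z : ℕ → ℝ) : V :=
  ∑' k, E k (z k)

namespace IsArmSystem

variable {V : Type*} [NormedAddCommGroup V] {E : ℕ → ℝ → V}

lemma starMap_single (hE : IsArmSystem E) (k : ℕ) (t : ℝ) : starMap E (Pi.single k t) = E k t := by
  rw [starMap, tsum_eq_single k]
  · simp
  · intro l hl
    simp [hl, hE.zero]

lemma starMap_eq (hE : IsArmSystem E) {z : ℕ → ℝ} (hz : z ∈ spikes) {k : ℕ} (hk : z k ≠ 0) :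
    starMap E z = E k (z k) := by
  conv_lhs => rw [eq_single_of_mem_spikes hz hk]
  exact hE.starMap_single k _

/-- This is what writing `starMap` as a series buys: the bounds on the arms make it converge
uniformly. -/
lemma continuous_starMap [CompleteSpace V] (hE : IsArmSystem E) : Continuous (starMap E) :=
  continuous_tsum (fun k => (hE.continuous k).comp (continuous_apply k))
    summable_geometric_two fun k z => hE.norm_le k (z k)

lemma injOn_starMap (hE : IsArmSystem E) : InjOn (starMap E) spikes := by
  intro z hz w hw h
  obtain ⟨k, hk⟩ := exists_eq_single_of_mem_spikes hz
  obtain ⟨l, hl⟩ := exists_eq_single_of_mem_spikes hw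
  rw [hk, hl, hE.starMap_single, hE.starMap_single] at h
  by_cases hkl : k = l
  · subst hkl
    rw [hk, hl, hE.injOn k (hz.1 k) (hw.1 k) h]
  · rw [hk, hl, hE.eq_zero k l hkl _ (hz.1 k) _ (hw.1 l) h,
      hE.eq_zero l k (Ne.symm hkl) _ (hw.1 l) _ (hz.1 k) h.symm, Pi.single_zero, Pi.single_zero]

lemma image_starMap (hE : IsArmSystem E) : starMap E '' spikes = ⋃ k, E k '' Icc 0 1 := by
  ext x
  simp only [mem_iUnion, mem_image]
  constructor
  · rintro ⟨z, hz, rfl⟩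
    obtain ⟨k, hk⟩ := exists_eq_single_of_mem_spikes hz
    exact ⟨k, z k, hz.1 k, by conv_rhs => rw [hk, hE.starMap_single]⟩
  · rintro ⟨k, t, ht, rfl⟩
    exact ⟨_, single_mem_spikes ht, hE.starMap_single k t⟩

lemma exists_homeomorph [CompleteSpace V] (hE : IsArmSystem E) :
    ∃ h : spikes ≃ₜ (⋃ k, E k '' Icc 0 1 : Set V), ∀ z, (h z : V) = starMap E z := by
  have hc : Continuous (spikes.domRestrict (starMap E)) :=
    hE.continuous_starMap.comp continuous_subtype_val
  have hi : Function.Injective (spikes.domRestrict (starMap E)) :=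
    injOn_iff_injective.1 hE.injOn_starMap
  have hr : range (spikes.domRestrict (starMap E)) = ⋃ k, E k '' Icc 0 1 := by
    rw [range_domRestrict, hE.image_starMap]
  exact ⟨(hc.isClosedEmbedding hi).isEmbedding.toHomeomorph.trans (Homeomorph.setCongr hr),
    fun z => rfl⟩

lemma isDendrite {V : Type u} [NormedAddCommGroup V] [CompleteSpace V] {E : ℕ → ℝ → V}
    (hE : IsArmSystem E) : IsDendrite (⋃ k, E k '' Icc 0 1 : Set V) := by
  obtain ⟨h, -⟩ := hE.exists_homeomorph
  refine ⟨⟨h.compactSpace, inferInstance, h.surjective.connectedSpace h.continuous,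
    h.symm.isOpenEmbedding.locallyConnectedSpace⟩, fun γ hγ hinj => ?_⟩
  exact not_injective_circle_spikes (h.symm ∘ γ) (h.symm.continuous.comp hγ)
    (h.symm.injective.comp hinj)

end IsArmSystem

/-! ### The star with straight arms as an IFS attractor. -/

/-- The space of bounded real sequences with the supremum norm. -/
abbrev BoundedSequences : Type := lp (fun _ : ℕ => ℝ) ∞

/-- The star in the space of bounded sequences whose `k`-th arm is the segment from `0` to
`2⁻ᵏ` times the `k`-th unit vector. -/
noncomputable def segmentArm (k : ℕ) (s : ℝ) : BoundedSequences :=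
  lp.single ∞ k ((1 / 2 : ℝ) ^ k * max 0 (min s 1))

lemma segmentArm_of_mem {k : ℕ} {s : ℝ} (hs : s ∈ Icc (0 : ℝ) 1) :
    segmentArm k s = lp.single ∞ k ((1 / 2 : ℝ) ^ k * s) := by
  rw [segmentArm, min_eq_left hs.2, max_eq_right hs.1]

lemma dist_lp_single (k : ℕ) (a b : ℝ) :
    dist (lp.single ∞ k a : BoundedSequences) (lp.single ∞ k b) = |a - b| := by
  rw [dist_eq_norm, ← lp.single_sub, lp.norm_single (by simp), Real.norm_eq_abs]

lemma isometry_lp_single (k : ℕ) : Isometry fun a : ℝ => (lp.single ∞ k a : BoundedSequences) :=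
  Isometry.of_dist_eq fun a b => dist_lp_single k a b

lemma isArmSystem_segmentArm : IsArmSystem segmentArm where
  continuous k := (isometry_lp_single k).continuous.comp (by fun_prop)
  zero k := by simp [segmentArm]
  norm_le k s := by
    have h : |max 0 (min s 1)| ≤ 1 := by
      rw [abs_of_nonneg (le_max_left _ _)]
      exact max_le zero_le_one (min_le_right _ _)
    rw [segmentArm, lp.norm_single (by simp), norm_mul, Real.norm_eq_abs, Real.norm_eq_abs,
      abs_of_pos (by positivity : (0 : ℝ) < (1 / 2) ^ k)]
    exact mul_le_of_le_one_right (by positivity) h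
  injOn k s hs t ht h := by
    rw [segmentArm_of_mem hs, segmentArm_of_mem ht] at h
    exact mul_left_cancel₀ (pow_pos one_half_pos k).ne' ((isometry_lp_single k).injective h)
  eq_zero k l hkl s hs t ht h := by
    rw [segmentArm_of_mem hs, segmentArm_of_mem ht] at h
    have := congrArg (fun x : BoundedSequences => x k) h
    simpa [lp.single_apply, Pi.single_eq_of_ne hkl] using this

/-- The shift of a bounded sequence to the right, scaled by `1 / 2`. -/
noncomputable def halfShift (x : BoundedSequences) : BoundedSequences :=
  ⟨fun n => Nat.casesOn n 0 fun m => x m / 2, by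
    refine memℓp_infty ⟨‖x‖, ?_⟩
    rintro _ ⟨n, rfl⟩
    cases n with
    | zero => simp
    | succ m =>
      have := lp.norm_apply_le_norm (p := ∞) (by simp) x m
      simp only [norm_div, Real.norm_ofNat]
      linarith [norm_nonneg (x m)]⟩

lemma halfShift_zero (x : BoundedSequences) : halfShift x 0 = 0 := rfl

lemma halfShift_succ (x : BoundedSequences) (m : ℕ) : halfShift x (m + 1) = x m / 2 := rfl

lemma lipschitzWith_halfShift : LipschitzWith (1 / 2) halfShift := by
  refine LipschitzWith.of_dist_le_mul fun x y => ?_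
  rw [dist_eq_norm, dist_eq_norm]
  refine lp.norm_le_of_forall_le (by positivity) fun n => ?_
  cases n with
  | zero => simp [halfShift_zero]
  | succ m =>
    have := lp.norm_apply_le_norm (p := ∞) (by simp) (x - y) m
    simp only [lp.coeFn_sub, Pi.sub_apply, halfShift_succ, ← sub_div, norm_div,
      Real.norm_ofNat] at this ⊢
    push_cast
    linarith

lemma halfShift_single (k : ℕ) (a : ℝ) :
    halfShift (lp.single ∞ k a) = lp.single ∞ (k + 1) (a / 2) := by
  ext n
  cases n with
  | zero => simp [halfShift_zero, lp.single_apply]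
  | succ m =>
    rw [halfShift_succ]
    by_cases h : m = k
    · subst h; simp [lp.single_apply]
    · simp [lp.single_apply, h]

/-- `halfShift` carries each arm onto the next one. The missing arm 0 is the image of the star under
two maps that factor through half the norm: one covers the lower half of the arm, the other the
upper half. -/
lemma isIFSAttractor_segmentStar : IsIFSAttractor (⋃ k, segmentArm k '' Icc 0 1) := by
  have hK : ∀ x, x ∈ (⋃ k, segmentArm k '' Icc 0 1 : Set BoundedSequences) ↔
      ∃ k : ℕ, ∃ a ∈ Icc (0 : ℝ) ((1 / 2) ^ k), x = lp.single ∞ k a := by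
    intro x
    simp only [mem_iUnion, mem_image]
    refine exists_congr fun k => ?_
    have hp : (0 : ℝ) < (1 / 2) ^ k := by positivity
    constructor
    · rintro ⟨s, hs, rfl⟩
      exact ⟨_, ⟨mul_nonneg hp.le hs.1, mul_le_of_le_one_right hp.le hs.2⟩, segmentArm_of_mem hs⟩
    · rintro ⟨a, ha, rfl⟩
      have hs : a / (1 / 2) ^ k ∈ Icc (0 : ℝ) 1 :=
        ⟨div_nonneg ha.1 hp.le, (div_le_one hp).2 ha.2⟩
      exact ⟨_, hs, by rw [segmentArm_of_mem hs, mul_div_cancel₀ _ hp.ne']⟩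
  set g : BoundedSequences → BoundedSequences := fun x => lp.single ∞ 0 (‖x‖ / 2) with hg
  set g' : BoundedSequences → BoundedSequences := fun x => lp.single ∞ 0 (1 - ‖x‖ / 2) with hg'
  have hnorm : ∀ x y : BoundedSequences, |‖x‖ / 2 - ‖y‖ / 2| ≤ 1 / 2 * dist x y := by
    intro x y
    rw [← sub_div, abs_div, abs_two, dist_eq_norm]
    linarith [abs_norm_sub_norm_le x y]
  have hlt : (1 / 2 : ℝ≥0) < 1 := by
    rw [← NNReal.coe_lt_coe]; norm_num
  refine ⟨{halfShift, g, g'}, ⟨by simp, ?_⟩, ?_, ?_, ?_⟩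
  · rintro f (rfl | rfl | rfl)
    · exact ⟨1 / 2, hlt, lipschitzWith_halfShift⟩
    · refine ⟨1 / 2, hlt, LipschitzWith.of_dist_le_mul fun x y => ?_⟩
      simp only [hg, dist_lp_single]
      simpa using hnorm x y
    · refine ⟨1 / 2, hlt, LipschitzWith.of_dist_le_mul fun x y => ?_⟩
      simp only [hg', dist_lp_single]
      have := hnorm y x
      rw [dist_comm] at this
      rw [show 1 - ‖x‖ / 2 - (1 - ‖y‖ / 2) = ‖y‖ / 2 - ‖x‖ / 2 by ring]
      simpa using this
  · exact ⟨0, (hK 0).2 ⟨0, 0, by simp, by simp⟩⟩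
  · rw [← isArmSystem_segmentArm.image_starMap]
    exact isCompact_spikes.image isArmSystem_segmentArm.continuous_starMap
  · have hns : ∀ (k : ℕ) (a : ℝ), 0 ≤ a → ‖(lp.single ∞ k a : BoundedSequences)‖ = a := by
      intro k a ha
      rw [lp.norm_single (by simp), Real.norm_of_nonneg ha]
    rw [biUnion_insert, biUnion_insert, biUnion_singleton]
    ext x
    simp only [mem_union, mem_image]
    constructor
    · intro hx
      obtain ⟨k, a, ha, rfl⟩ := (hK x).1 hx
      cases k with
      | zero =>
        rw [pow_zero] at ha
        rcases le_total a (1 / 2) with h | h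
        · refine Or.inr (Or.inl ⟨lp.single ∞ 0 (2 * a),
            (hK _).2 ⟨0, 2 * a, ⟨by linarith [ha.1], by linarith⟩, rfl⟩, ?_⟩)
          simp only [hg]
          rw [hns _ _ (by linarith [ha.1])]
          congr 1; ring
        · refine Or.inr (Or.inr ⟨lp.single ∞ 0 (2 - 2 * a),
            (hK _).2 ⟨0, 2 - 2 * a, ⟨by linarith [ha.2], by linarith⟩, rfl⟩, ?_⟩)
          simp only [hg']
          rw [hns _ _ (by linarith [ha.2])]
          congr 1; ring
      | succ k =>
        rw [pow_succ] at ha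
        refine Or.inl ⟨lp.single ∞ k (2 * a),
          (hK _).2 ⟨k, 2 * a, ⟨by linarith [ha.1], by linarith [ha.2]⟩, rfl⟩, ?_⟩
        rw [halfShift_single]
        congr 1; ring
    · rintro (⟨y, hy, rfl⟩ | ⟨y, hy, rfl⟩ | ⟨y, hy, rfl⟩) <;>
        obtain ⟨k, a, ha, rfl⟩ := (hK y).1 hy
      · refine (hK _).2 ⟨k + 1, a / 2, ⟨by linarith [ha.1], ?_⟩, halfShift_single k a⟩
        rw [pow_succ]; linarith [ha.2]
      all_goals
        have h1 : a ≤ 1 := ha.2.trans (pow_le_one₀ (by norm_num) (by norm_num))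
        have h0 := ha.1
      · refine (hK _).2 ⟨0, a / 2, ⟨by linarith, by rw [pow_zero]; linarith⟩, ?_⟩
        simp only [hg]
        rw [hns _ _ h0]
      · refine (hK _).2 ⟨0, 1 - a / 2, ⟨by linarith, by rw [pow_zero]; linarith⟩, ?_⟩
        simp only [hg']
        rw [hns _ _ h0]

lemma IsArmSystem.isBanachFractal {V : Type} [NormedAddCommGroup V] [CompleteSpace V]
    {E : ℕ → ℝ → V} (hE : IsArmSystem E) : IsBanachFractal (⋃ k, E k '' Icc 0 1 : Set V) := by
  obtain ⟨h, -⟩ := hE.exists_homeomorph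
  obtain ⟨h', -⟩ := isArmSystem_segmentArm.exists_homeomorph
  exact ⟨h.compactSpace, inferInstance, BoundedSequences, inferInstance, inferInstance, _,
    isIFSAttractor_segmentStar, ⟨h.symm.trans h'⟩⟩

/-! ### Strict contractions of a star. -/

lemma mem_iUnion_image {V : Type*} {E : ℕ → ℝ → V} (k : ℕ) {s : ℝ} (hs : s ∈ Icc (0 : ℝ) 1) :
    E k s ∈ ⋃ k, E k '' Icc 0 1 := mem_iUnion.2 ⟨k, s, hs, rfl⟩

namespace IsArmSystem

section Path

variable {V : Type*} [NormedAddCommGroup V] {E : ℕ → ℝ → V}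

/-- A path from the centre of the star to the end of an arm is at least as long as the arm. -/
lemma eVariationOn_le_of_eq_zero (hE : IsArmSystem E) {w : ℝ → ℕ → ℝ} {a b : ℝ} (hab : a ≤ b)
    (hw : ContinuousOn w (Icc a b)) (hmem : ∀ s ∈ Icc a b, w s ∈ spikes) {n : ℕ}
    (ha : w a = 0) (hb : w b n = 1) :
    eVariationOn (E n) (Icc 0 1) ≤ eVariationOn (starMap E ∘ w) (Icc a b) := by
  have hc : ContinuousOn (fun s => w s n) (Icc a b) :=
    (continuous_apply n).comp_continuousOn hw
  -- `sInf (T u)` is the first time at which coordinate `n` reaches the level `u`. It is monotone in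
  -- `u`, so the arm is a monotone reparametrization of part of the path.
  set T : ℝ → Set ℝ := fun u => {s ∈ Icc a b | u ≤ w s n} with hT
  have hTne : ∀ u ∈ Icc (0 : ℝ) 1, (T u).Nonempty := fun u hu =>
    ⟨b, right_mem_Icc.2 hab, by rw [hb]; exact hu.2⟩
  have hTc : ∀ u, IsCompact (T u) := by
    intro u
    have : T u = Icc a b ∩ (fun s => w s n) ⁻¹' Ici u := rfl
    rw [this]
    exact isCompact_Icc.of_isClosed_subset (hc.preimage_isClosed_of_isClosed isClosed_Icc isClosed_Ici)
      inter_subset_left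
  have hmemT : ∀ u ∈ Icc (0 : ℝ) 1, sInf (T u) ∈ T u := fun u hu =>
    (hTc u).sInf_mem (hTne u hu)
  have hval : ∀ u ∈ Icc (0 : ℝ) 1, w (sInf (T u)) n = u := by
    intro u hu
    obtain ⟨⟨h1, h2⟩, h3⟩ := hmemT u hu
    have h4 : u ∈ Icc (w a n) (w (sInf (T u)) n) := ⟨by rw [ha]; exact hu.1, h3⟩
    obtain ⟨s, hs, hsu⟩ := intermediate_value_Icc h1 (hc.mono (Icc_subset_Icc_right h2)) h4
    have h5 : sInf (T u) ≤ s :=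
      csInf_le (hTc u).bddBelow ⟨⟨hs.1, hs.2.trans h2⟩, hsu.ge⟩
    rw [← le_antisymm hs.2 h5]
    exact hsu
  have hEq : EqOn (E n) ((starMap E ∘ w) ∘ fun u => sInf (T u)) (Icc 0 1) := by
    intro u hu
    obtain ⟨hmT, -⟩ := hmemT u hu
    by_cases h0 : u = 0
    · subst h0
      have h1 : sInf (T 0) = a :=
        le_antisymm (csInf_le (hTc 0).bddBelow ⟨left_mem_Icc.2 hab, by simp [ha]⟩) hmT.1
      have h2 := hE.starMap_single n 0
      rw [Pi.single_zero] at h2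
      simp [h1, ha, h2]
    · have h1 := hval u hu
      have h2 := hE.starMap_eq (hmem _ hmT) (k := n) (by rwa [h1])
      simp only [Function.comp_apply]
      rw [h2, h1]
  rw [eVariationOn.congr hEq]
  refine eVariationOn.comp_le_of_monotoneOn _ _ ?_ fun u hu => (hmemT u hu).1
  intro u hu v hv huv
  exact csInf_le_csInf (hTc u).bddBelow (hTne v hv) fun s hs => ⟨hs.1, huv.trans hs.2⟩

/-- A path from a point outside an arm to the end of the arm is at least as long as the arm. -/
lemma eVariationOn_le_of_path [CompleteSpace V] (hE : IsArmSystem E) {w : ℝ → ℕ → ℝ} {a b : ℝ}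
    (hab : a ≤ b) (hw : ContinuousOn w (Icc a b)) (hmem : ∀ s ∈ Icc a b, w s ∈ spikes) {n : ℕ}
    (ha : w a n = 0) (hb : w b n = 1) :
    eVariationOn (E n) (Icc 0 1) ≤ eVariationOn (starMap E ∘ w) (Icc a b) := by
  have hc : ContinuousOn (fun s => w s n) (Icc a b) :=
    (continuous_apply n).comp_continuousOn hw
  -- Off arm `n` this function is minus the distance to the centre; on the arm the norm vanishes and
  -- the coordinate remains. Its only zero on the star is the centre, so the intermediate value
  -- theorem makes the path pass there.
  have hψ : ContinuousOn (fun s => w s n - ‖starMap E (w s) - E n (w s n)‖) (Icc a b) :=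
    hc.sub ((hE.continuous_starMap.comp_continuousOn hw).sub
      ((hE.continuous n).comp_continuousOn hc)).norm
  have h0 : (0 : ℝ) ∈ Icc (w a n - ‖starMap E (w a) - E n (w a n)‖)
      (w b n - ‖starMap E (w b) - E n (w b n)‖) := by
    rw [ha, hb, hE.starMap_eq (hmem b (right_mem_Icc.2 hab)) (k := n) (by rw [hb]; exact one_ne_zero),
      hb]
    simp
  obtain ⟨c, hc', hc0⟩ := intermediate_value_Icc hab hψ h0
  have hcn : w c n = 0 := by
    by_contra h
    have := hE.starMap_eq (hmem c hc') h
    simp only [this, sub_self, norm_zero, sub_zero] at hc0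
    exact h hc0
  have hwc : w c = 0 := by
    refine hE.injOn_starMap (hmem c hc') zero_mem_spikes ?_
    have h2 := hE.starMap_single n 0
    rw [Pi.single_zero, hE.zero] at h2
    rw [h2]
    simpa [hcn, hE.zero] using hc0
  have hsub : Icc c b ⊆ Icc a b := Icc_subset_Icc_left hc'.1
  exact (hE.eVariationOn_le_of_eq_zero hc'.2 (hw.mono hsub) (fun s hs => hmem s (hsub hs)) hwc hb).trans
    (eVariationOn.mono _ hsub)

lemma exists_coordinates [CompleteSpace V] (hE : IsArmSystem E) :
    ∃ c : V → ℕ → ℝ, ContinuousOn c (⋃ k, E k '' Icc 0 1) ∧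
      ∀ x ∈ ⋃ k, E k '' Icc 0 1, c x ∈ spikes ∧ starMap E (c x) = x := by
  classical
  obtain ⟨h, hh⟩ := hE.exists_homeomorph
  refine ⟨fun x => if hx : x ∈ ⋃ k, E k '' Icc 0 1 then h.symm ⟨x, hx⟩ else 0, ?_, fun x hx => ?_⟩
  · rw [continuousOn_iff_continuous_domRestrict]
    refine (continuous_subtype_val.comp h.symm.continuous).congr fun x => ?_
    simp only [Function.comp_apply, domRestrict_apply]
    rw [dif_pos x.2]
  · simp only [dif_pos hx]
    exact ⟨(h.symm ⟨x, hx⟩).2, by rw [← hh, h.apply_symm_apply]⟩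

end Path

section Weak

variable {V : Type*} [NormedAddCommGroup V] [CompleteSpace V] {E : ℕ → ℝ → V}

/-- If the lengths of the arms increase and their diameters are attained at their ends and decrease,
then a strict contraction of the star covers the ends of finitely many arms only. -/
lemma finite_setOf_end_mem_image (hE : IsArmSystem E)
    (hlen : StrictMono fun n => eVariationOn (E n) (Icc 0 1))
    (hend : ∀ n m, n ≤ m → ∀ s, ‖E m s‖ ≤ ‖E n 1‖) {g : V → V}
    (hmaps : MapsTo g (⋃ k, E k '' Icc 0 1) (⋃ k, E k '' Icc 0 1))
    (hg : ∀ x ∈ ⋃ k, E k '' Icc 0 1, ∀ y ∈ ⋃ k, E k '' Icc 0 1, x ≠ y →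
      dist (g x) (g y) < dist x y) :
    {n | E n 1 ∈ g '' ⋃ k, E k '' Icc 0 1}.Finite := by
  obtain ⟨c, hc, hcE⟩ := hE.exists_coordinates
  have h01 : (0 : ℝ) ∈ Icc (0 : ℝ) 1 := by simp
  have h11 : (1 : ℝ) ∈ Icc (0 : ℝ) 1 := by simp
  have h0P : (0 : V) ∈ ⋃ k, E k '' Icc 0 1 := hE.zero 0 ▸ mem_iUnion_image 0 h01
  have hg0 := hmaps h0P
  have hle : ∀ x ∈ ⋃ k, E k '' Icc 0 1, ∀ y ∈ ⋃ k, E k '' Icc 0 1, dist (g x) (g y) ≤ dist x y := by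
    intro x hx y hy
    by_cases h : x = y
    · simp [h]
    · exact (hg x hx y hy h).le
  have hlip : LipschitzOnWith 1 g (⋃ k, E k '' Icc 0 1) :=
    LipschitzOnWith.of_dist_le_mul fun x hx y hy => by simpa using hle x hx y hy
  -- The image of the part of arm `m` up to `s` ends at tip `n`, hence is at least as long as arm
  -- `n`; `g` does not increase length.
  have key : ∀ n m s, s ∈ Icc (0 : ℝ) 1 → g (E m s) = E n 1 → c (g 0) n = 0 → n ≤ m := by
    intro n m s hs hgs h0
    have hsub : Icc 0 s ⊆ Icc (0 : ℝ) 1 := Icc_subset_Icc_right hs.2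
    have hm : ∀ t ∈ Icc 0 s, E m t ∈ ⋃ k, E k '' Icc 0 1 := fun t ht =>
      mem_iUnion_image m (hsub ht)
    have h1 : c (g (E m s)) = Pi.single n 1 := by
      have hP := mem_iUnion_image (E := E) n h11
      rw [hgs]
      refine hE.injOn_starMap (hcE _ hP).1 (single_mem_spikes h11) ?_
      rw [(hcE _ hP).2, hE.starMap_single]
    have h2 := hE.eVariationOn_le_of_path (w := fun t => c (g (E m t))) (n := n) hs.1
      (hc.comp (hlip.continuousOn.comp (hE.continuous m).continuousOn hm)
        fun t ht => hmaps (hm t ht))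
      (fun t ht => (hcE _ (hmaps (hm t ht))).1) (by simpa only [hE.zero] using h0)
      (by simp [h1])
    have h3 : EqOn (starMap E ∘ fun t => c (g (E m t))) (g ∘ E m) (Icc 0 s) := fun t ht =>
      (hcE _ (hmaps (hm t ht))).2
    rw [eVariationOn.congr h3] at h2
    have h4 := hlip.comp_eVariationOn_le (g := E m) (s := Icc 0 s) hm
    rw [ENNReal.coe_one, one_mul] at h4
    exact hlen.le_iff_le.1 (h2.trans (h4.trans (eVariationOn.mono _ hsub)))
  by_cases hz : g 0 = 0
  · convert finite_empty
    rw [eq_empty_iff_forall_notMem]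
    rintro n ⟨x, hx, hxn⟩
    obtain ⟨m, s, hs, rfl⟩ : ∃ m, ∃ s ∈ Icc (0 : ℝ) 1, E m s = x := by simpa using hx
    have hc0 : c (g 0) = 0 := by
      refine hE.injOn_starMap (hcE _ hg0).1 zero_mem_spikes ?_
      have h2 := hE.starMap_single n 0
      rw [Pi.single_zero, hE.zero] at h2
      rw [(hcE _ hg0).2, h2, hz]
    have hnm := key n m s hs hxn (by rw [hc0]; rfl)
    have hne : E m s ≠ 0 := by
      intro h
      rw [h, hz, ← hE.zero n] at hxn
      exact zero_ne_one (hE.injOn n h01 h11 hxn)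
    have := hg _ hx 0 h0P hne
    rw [hz, hxn, dist_zero_right, dist_zero_right] at this
    exact this.not_ge (hend n m hnm s)
  -- The index `j` is that of an arm containing `g 0`, to which `key` need not apply. For other
  -- covered tips, `‖g 0‖ ≤ 2 * (1 / 2) ^ n`.
  · obtain ⟨j, hj⟩ := exists_eq_single_of_mem_spikes (hcE _ hg0).1
    have hfin : {n : ℕ | ¬ (2 * (1 / 2 : ℝ) ^ n < ‖g 0‖)}.Finite := by
      have : Tendsto (fun n : ℕ => 2 * (1 / 2 : ℝ) ^ n) atTop (𝓝 (2 * 0)) :=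
        (tendsto_pow_atTop_nhds_zero_of_lt_one (by norm_num) (by norm_num)).const_mul 2
      rw [mul_zero] at this
      have h := this.eventually_lt_const (norm_pos_iff.2 hz)
      rwa [← Nat.cofinite_eq_atTop, eventually_cofinite] at h
    refine (hfin.union (finite_singleton j)).subset ?_
    rintro n ⟨x, hx, hxn⟩
    by_cases hnj : n = j
    · exact Or.inr hnj
    left
    obtain ⟨m, s, hs, rfl⟩ : ∃ m, ∃ s ∈ Icc (0 : ℝ) 1, E m s = x := by simpa using hx
    have hnm := key n m s hs hxn (by rw [hj, Pi.single_eq_of_ne hnj])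
    have h1 := hle _ hx 0 h0P
    rw [hxn, dist_zero_right] at h1
    have h2 : (1 / 2 : ℝ) ^ m ≤ (1 / 2) ^ n :=
      pow_le_pow_of_le_one (by norm_num) (by norm_num) hnm
    have h3 := hE.norm_le m s
    have h4 := hE.norm_le n 1
    have h5 : ‖g 0‖ ≤ ‖E n 1‖ + dist (E n 1) (g 0) := by
      rw [dist_eq_norm]
      simpa using norm_sub_le (E n 1) (E n 1 - g 0)
    change ¬ _
    rw [not_lt]
    linarith

lemma not_isWeakIFSAttractor_range (hE : IsArmSystem E)
    (hlen : StrictMono fun n => eVariationOn (E n) (Icc 0 1))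
    (hend : ∀ n m, n ≤ m → ∀ s, ‖E m s‖ ≤ ‖E n 1‖) {X : Type*} [MetricSpace X]
    (ι : (⋃ k, E k '' Icc 0 1 : Set V) → X) (hι : Isometry ι) :
    ¬ IsWeakIFSAttractor (range ι) := by
  classical
  rintro ⟨F, ⟨hF, hcontr⟩, -, -, hA⟩
  have h11 : (1 : ℝ) ∈ Icc (0 : ℝ) 1 := by simp
  have hfin : ∀ f ∈ F, {n | ι ⟨E n 1, mem_iUnion_image n h11⟩ ∈ f '' range ι}.Finite := by
    intro f hf
    have hinv : ∀ x, ∃ y, ι y = f (ι x) := by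
      intro x
      have : f (ι x) ∈ range ι := by
        rw [hA]
        exact mem_biUnion hf (mem_image_of_mem f (mem_range_self x))
      exact this
    choose q hq using hinv
    -- `f` transported to the star along the isometry; the value 0 elsewhere is arbitrary.
    set g : V → V := fun x => if hx : x ∈ ⋃ k, E k '' Icc 0 1 then q ⟨x, hx⟩ else 0 with hg
    have hgq : ∀ x (hx : x ∈ ⋃ k, E k '' Icc 0 1), g x = q ⟨x, hx⟩ := fun x hx => by
      simp only [hg, dif_pos hx]
    refine (hE.finite_setOf_end_mem_image hlen hend (g := g) ?_ ?_).subset ?_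
    · intro x hx
      rw [hgq x hx]
      exact (q ⟨x, hx⟩).2
    · intro x hx y hy hxy
      rw [hgq x hx, hgq y hy, ← Subtype.dist_eq, ← hι.dist_eq, hq, hq]
      have hne : (⟨x, hx⟩ : (⋃ k, E k '' Icc 0 1 : Set V)) ≠ ⟨y, hy⟩ := fun h =>
        hxy (congrArg Subtype.val h)
      have := hcontr f hf _ _ (hι.injective.ne hne)
      rwa [hι.dist_eq, Subtype.dist_eq] at this
    · rintro n ⟨_, ⟨x, rfl⟩, hx⟩
      refine ⟨x, x.2, ?_⟩
      rw [hgq x x.2]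
      rw [← hq] at hx
      exact congrArg Subtype.val (hι.injective hx)
  refine infinite_univ ((hF.biUnion hfin).subset fun n _ => ?_)
  have : ι ⟨E n 1, mem_iUnion_image n h11⟩ ∈ range ι := mem_range_self _
  rw [hA] at this
  obtain ⟨f, hf, hx⟩ := mem_iUnion₂.1 this
  exact mem_biUnion hf hx

end Weak

end IsArmSystem

/-! ### Polar coordinates, and arm families as arm systems. -/

lemma norm_polarPoint {r : ℝ} (hr : 0 ≤ r) (α : ℝ) : ‖polarPoint r α‖ = r := by
  rw [EuclideanSpace.norm_eq, polarPoint]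
  simp only [Fin.sum_univ_two, Real.norm_eq_abs, sq_abs]
  simp only [Matrix.cons_val_zero, Matrix.cons_val_one]
  rw [show (r * Real.cos α) ^ 2 + (r * Real.sin α) ^ 2 = r ^ 2 by
    linear_combination r ^ 2 * Real.sin_sq_add_cos_sq α]
  exact Real.sqrt_sq hr

lemma polarPoint_injective {r r' α α' : ℝ} (hr : 0 < r) (hr' : 0 ≤ r')
    (hα : α ∈ Icc 0 Real.pi) (hα' : α' ∈ Icc 0 Real.pi)
    (h : polarPoint r α = polarPoint r' α') : r = r' ∧ α = α' := by
  have h1 : r = r' := by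
    rw [← norm_polarPoint hr.le α, h, norm_polarPoint hr']
  refine ⟨h1, ?_⟩
  have h2 := congrArg (fun x : Plane => x 0) h
  simp only [polarPoint, PiLp.toLp_apply, Matrix.cons_val_zero, ← h1] at h2
  exact Real.injOn_cos hα hα' (mul_left_cancel₀ hr.ne' h2)

lemma exists_polar_of_mem {n : ℕ} {x : Plane} (hx : x ∈ sector n ∪ {tipPoint n}) :
    ∃ r α : ℝ, 0 ≤ r ∧ r ≤ (1 / 2 : ℝ) ^ n ∧ 3 / 4 * (1 / 2 : ℝ) ^ n < α ∧
      α < 5 / 4 * (1 / 2 : ℝ) ^ n ∧ x = polarPoint r α := by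
  have hp : (0 : ℝ) < (1 / 2) ^ n := by positivity
  rcases hx with ⟨r, α, h0, h1, h2, h3, h4⟩ | hx
  · rw [pow_add] at h2 h3
    exact ⟨r, α, h0, h1.le, by linarith, by linarith, h4⟩
  · exact ⟨_, _, hp.le, le_rfl, by linarith, by linarith, hx⟩

/-- The angles of sector `m` stay below 5/4 · 2⁻ᵐ ≤ 5/8 · 2⁻ⁿ, those of sector `n` above 3/4 · 2⁻ⁿ.
All lie in [0, π], where a nonzero point determines its angle. -/
lemma eq_zero_of_mem_sectors {n m : ℕ} (hn : 1 ≤ n) (hnm : n < m) {x : Plane}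
    (hx : x ∈ sector n ∪ {tipPoint n}) (hx' : x ∈ sector m ∪ {tipPoint m}) : x = 0 := by
  obtain ⟨r, α, h0, h1, h2, h3, rfl⟩ := exists_polar_of_mem hx
  obtain ⟨r', α', h0', h1', h2', h3', h⟩ := exists_polar_of_mem hx'
  rw [← norm_eq_zero, norm_polarPoint h0]
  by_contra hr
  have hn2 : (1 / 2 : ℝ) ^ n ≤ 1 / 2 := by
    simpa using pow_le_pow_of_le_one (by norm_num : (0 : ℝ) ≤ 1 / 2) (by norm_num) hn
  have hm2 : (1 / 2 : ℝ) ^ m ≤ (1 / 2) ^ n * (1 / 2) := by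
    rw [← pow_succ]
    exact pow_le_pow_of_le_one (by norm_num) (by norm_num) hnm
  have hp : (0 : ℝ) < (1 / 2) ^ n := by positivity
  have hp' : (0 : ℝ) < (1 / 2) ^ m := by positivity
  have hpi := Real.pi_gt_three
  have := (polarPoint_injective (h0.lt_of_ne (Ne.symm hr)) h0' ⟨by linarith, by linarith⟩
    ⟨by linarith, by linarith⟩ h).2
  linarith

lemma IsArmFamily.exists_isArmSystem {L : ℕ → Set Plane} (hL : IsArmFamily L) :
    ∃ E : ℕ → ℝ → Plane, IsArmSystem E ∧ armUnion L = ⋃ k, E k '' Icc 0 1 ∧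
      (∀ k, eVariationOn (E k) (Icc 0 1) = 2 ^ (k + 1)) ∧
      ∀ n m, n ≤ m → ∀ s, ‖E m s‖ ≤ ‖E n 1‖ := by
  have h1 : ∀ k : ℕ, 1 ≤ k + 1 := fun k => by omega
  choose e hec hei heL he0 he1 _ hev using fun k => (hL (k + 1) (h1 k)).1
  have hsub := fun k => (hL (k + 1) (h1 k)).2
  -- Clamping to the unit interval makes the arcs continuous on the whole line. The index shifts by
  -- one: arm `k` is `L (k + 1)`.
  set p : ℝ → ℝ := fun s => max 0 (min s 1) with hp
  have hpc : Continuous p := by fun_prop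
  have hpm : ∀ s, p s ∈ Icc (0 : ℝ) 1 := fun s =>
    ⟨le_max_left _ _, max_le zero_le_one (min_le_right _ _)⟩
  have hps : ∀ s ∈ Icc (0 : ℝ) 1, p s = s := fun s hs => by
    simp only [hp]
    rw [min_eq_left hs.2, max_eq_right hs.1]
  have hEq : ∀ k, EqOn (e k ∘ p) (e k) (Icc 0 1) := fun k s hs => congrArg (e k) (hps s hs)
  have hmem : ∀ k s, e k (p s) ∈ sector (k + 1) ∪ {tipPoint (k + 1)} := fun k s =>
    hsub k (heL k ▸ mem_image_of_mem _ (hpm s))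
  have hnorm : ∀ k s, ‖e k (p s)‖ ≤ (1 / 2 : ℝ) ^ (k + 1) := by
    intro k s
    obtain ⟨r, α, h0, h1, -, -, h⟩ := exists_polar_of_mem (hmem k s)
    rwa [h, norm_polarPoint h0]
  have hmono : ∀ n m : ℕ, n ≤ m → (1 / 2 : ℝ) ^ m ≤ (1 / 2) ^ n := fun n m h =>
    pow_le_pow_of_le_one (by norm_num) (by norm_num) h
  refine ⟨fun k => e k ∘ p, ⟨?_, ?_, ?_, ?_, ?_⟩, ?_, ?_, ?_⟩
  · exact fun k => (hec k).comp_continuous hpc hpm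
  · intro k
    rw [hEq k (by simp), he0]
  · exact fun k s => (hnorm k s).trans (hmono _ _ (Nat.le_succ k))
  · exact fun k => (hei k).congr (hEq k).symm
  · intro k l hkl s hs t ht h
    have hz : e k (p s) = 0 := by
      rcases lt_or_gt_of_ne hkl with h' | h'
      · refine eq_zero_of_mem_sectors (h1 k) (Nat.succ_lt_succ h') (hmem k s) ?_
        rw [show e k (p s) = e l (p t) from h]
        exact hmem l t
      · refine eq_zero_of_mem_sectors (h1 l) (Nat.succ_lt_succ h') ?_ (hmem k s)
        rw [show e k (p s) = e l (p t) from h]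
        exact hmem l t
    rw [hps s hs, ← he0 k] at hz
    exact hei k hs (by simp) hz
  · rw [armUnion]
    ext x
    simp only [mem_iUnion, (hEq _).image_eq, heL]
    constructor
    · rintro ⟨n, hn, hx⟩
      exact ⟨n - 1, by rwa [Nat.sub_add_cancel hn]⟩
    · rintro ⟨k, hx⟩
      exact ⟨k + 1, h1 k, hx⟩
  · intro k
    rw [eVariationOn.congr (hEq k), hev]
  · intro n m hnm s
    change ‖e m (p s)‖ ≤ ‖e n (p 1)‖
    rw [hps 1 (by simp), he1, tipPoint, norm_polarPoint (by positivity)]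
    exact (hnorm m s).trans (hmono _ _ (Nat.succ_le_succ hnm))

lemma strictMono_two_pow_succ : StrictMono fun k : ℕ => (2 : ℝ≥0∞) ^ (k + 1) := by
  intro k l hkl
  have : 2 ^ (k + 1) < 2 ^ (l + 1) := Nat.pow_lt_pow_right (by norm_num) (by omega)
  change (2 : ℝ≥0∞) ^ (k + 1) < 2 ^ (l + 1)
  exact_mod_cast this

/-! ### Construction of arms of prescribed length. -/

lemma eVariationOn_Icc_of_affine {V : Type*} [NormedAddCommGroup V] [NormedSpace ℝ V] {e : ℝ → V}
    {a b : ℝ} (hab : a < b) (he : ∀ s ∈ Icc (0 : ℝ) 1,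
      e (AffineMap.lineMap a b s) = AffineMap.lineMap (e a) (e b) s) :
    eVariationOn e (Icc a b) = edist (e a) (e b) := by
  have hba : 0 < b - a := sub_pos.2 hab
  apply le_antisymm
  · set φ : ℝ → ℝ := fun x => (x - a) / (b - a) with hφ
    have hmono : Monotone φ := fun x y hxy => by
      simp only [hφ]
      gcongr
    have hEq : EqOn e ((AffineMap.lineMap (e a) (e b) : ℝ → V) ∘ φ) (Icc a b) := by
      intro x hx
      rw [Function.comp_apply, ← he (φ x) ⟨div_nonneg (sub_nonneg.2 hx.1) hba.le,
        (div_le_one hba).2 (by linarith [hx.2])⟩]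
      congr 1
      rw [AffineMap.lineMap_apply_ring', hφ]
      field_simp
      ring
    rw [eVariationOn.congr hEq]
    refine ((lipschitzWith_lineMap (𝕜 := ℝ) (e a) (e b)).lipschitzOnWith (s := univ)
      |>.comp_eVariationOn_le (mapsTo_univ _ _)).trans ?_
    have h1 := (hmono.monotoneOn (Icc a b)).eVariationOn_eq (left_mem_Icc.2 hab.le)
      (right_mem_Icc.2 hab.le)
    rw [inter_self] at h1
    rw [h1, edist_nndist]
    simp only [hφ, sub_self, zero_div, sub_zero]
    rw [div_self hba.ne']
    simp
  · exact eVariationOn.edist_le e (left_mem_Icc.2 hab.le) (right_mem_Icc.2 hab.le)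

/-- The triangle wave of period `1` and height `1`. -/
noncomputable def triangleWave (x : ℝ) : ℝ := 1 - |2 * Int.fract x - 1|

lemma continuous_triangleWave : Continuous triangleWave := by
  have h : ContinuousOn (fun x : ℝ => 1 - |2 * x - 1|) (Icc 0 1) := by fun_prop
  exact h.comp_fract'' (by norm_num)

lemma triangleWave_mem_Icc (x : ℝ) : triangleWave x ∈ Icc (0 : ℝ) 1 := by
  have h0 := Int.fract_nonneg x
  have h1 := (Int.fract_lt_one x).le
  refine ⟨?_, ?_⟩
  · rw [triangleWave, sub_nonneg, abs_le]
    constructor <;> linarith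
  · rw [triangleWave]
    linarith [abs_nonneg (2 * Int.fract x - 1)]

lemma triangleWave_nat (j : ℕ) : triangleWave j = 0 := by
  simp [triangleWave]

lemma triangleWave_ascending (j : ℕ) {s : ℝ} (hs : s ∈ Icc (0 : ℝ) 1) :
    triangleWave (j + s / 2) = s := by
  have h : Int.fract ((j : ℝ) + s / 2) = s / 2 := by
    rw [Int.fract_natCast_add, Int.fract_eq_self.2 ⟨by linarith [hs.1], by linarith [hs.2]⟩]
  rw [triangleWave, h, abs_of_nonpos (by linarith [hs.2])]
  ring

lemma triangleWave_descending (j : ℕ) {s : ℝ} (hs : s ∈ Icc (0 : ℝ) 1) :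
    triangleWave (j + (1 + s) / 2) = 1 - s := by
  by_cases h1 : s = 1
  · subst h1
    have := triangleWave_nat (j + 1)
    push_cast at this
    norm_num [this]
  · have hlt := lt_of_le_of_ne hs.2 h1
    have h : Int.fract ((j : ℝ) + (1 + s) / 2) = (1 + s) / 2 := by
      rw [Int.fract_natCast_add, Int.fract_eq_self.2 ⟨by linarith [hs.1], by linarith⟩]
    rw [triangleWave, h, abs_of_nonneg (by linarith [hs.1])]
    ring

/-- There is a piecewise linear function with nodes at the integers that oscillates between `0`
and `h` on `[2K, 6K]` and vanishes elsewhere. -/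
lemma exists_zigzag (K : ℕ) {h : ℝ} (hh : 0 ≤ h) :
    ∃ G : ℝ → ℝ, Continuous G ∧ (∀ q, G q ∈ Icc 0 h) ∧ (∀ q : ℝ, q ≤ 2 * K → G q = 0) ∧
      (∀ q : ℝ, 6 * K ≤ q → G q = 0) ∧
      (∀ i : ℕ, 2 * K ≤ i → i < 6 * K → (G (i + 1) - G i) ^ 2 = h ^ 2) ∧
      ∀ i : ℕ, ∀ s ∈ Icc (0 : ℝ) 1, G (i + s) = (1 - s) * G i + s * G (i + 1) := by
  -- Both clamping bounds are even, so `p q / 2` is an integer, a zero of the wave, outside the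
  -- oscillating range.
  set p : ℝ → ℝ := fun q => max (2 * K) (min q (6 * K)) with hp
  have hK : (0 : ℝ) ≤ K := Nat.cast_nonneg K
  have hlow : ∀ q : ℝ, q ≤ 2 * K → p q = 2 * K := fun q hq => by
    simp only [hp]
    exact max_eq_left ((min_le_left _ _).trans hq)
  have hhigh : ∀ q : ℝ, 6 * K ≤ q → p q = 6 * K := fun q hq => by
    simp only [hp]
    rw [min_eq_right hq, max_eq_right (by linarith)]
  have hmid : ∀ q : ℝ, 2 * K ≤ q → q ≤ 6 * K → p q = q := fun q h1 h2 => by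
    simp only [hp]
    rw [min_eq_left h2, max_eq_right h1]
  have hl0 : ∀ q : ℝ, q ≤ 2 * K → h * triangleWave (p q / 2) = 0 := fun q hq => by
    rw [hlow q hq, mul_div_cancel_left₀ _ (two_ne_zero), triangleWave_nat, mul_zero]
  have hh0 : ∀ q : ℝ, 6 * K ≤ q → h * triangleWave (p q / 2) = 0 := fun q hq => by
    have := triangleWave_nat (3 * K)
    push_cast at this
    rw [hhigh q hq, show (6 * K / 2 : ℝ) = 3 * K by ring, this, mul_zero]
  have hpiece : ∀ i : ℕ, 2 * K ≤ i → i < 6 * K →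
      (∀ s ∈ Icc (0 : ℝ) 1, h * triangleWave (p (i + s) / 2) = h * s) ∨
      (∀ s ∈ Icc (0 : ℝ) 1, h * triangleWave (p (i + s) / 2) = h * (1 - s)) := by
    intro i hi1 hi2
    have h1 : (2 * K : ℝ) ≤ i := by exact_mod_cast hi1
    have h2 : (i + 1 : ℝ) ≤ 6 * K := by exact_mod_cast hi2
    rcases Nat.even_or_odd' i with ⟨j, hj | hj⟩
    · left
      intro s hs
      rw [hmid _ (by linarith [hs.1]) (by linarith [hs.2]), hj,
        show (((2 * j : ℕ) : ℝ) + s) / 2 = j + s / 2 by push_cast; ring,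
        triangleWave_ascending j hs]
    · right
      intro s hs
      rw [hmid _ (by linarith [hs.1]) (by linarith [hs.2]), hj,
        show (((2 * j + 1 : ℕ) : ℝ) + s) / 2 = j + (1 + s) / 2 by push_cast; ring,
        triangleWave_descending j hs]
  have h0 : (0 : ℝ) ∈ Icc (0 : ℝ) 1 := by simp
  have h1 : (1 : ℝ) ∈ Icc (0 : ℝ) 1 := by simp
  refine ⟨fun q => h * triangleWave (p q / 2), ?_, ?_, hl0, hh0, ?_, ?_⟩
  · have hpc : Continuous p := by fun_prop
    exact continuous_const.mul (continuous_triangleWave.comp (hpc.div_const 2))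
  · intro q
    have := triangleWave_mem_Icc (p q / 2)
    exact ⟨mul_nonneg hh this.1, mul_le_of_le_one_right hh this.2⟩
  · intro i hi1 hi2
    rcases hpiece i hi1 hi2 with H | H
    · have e0 := H 0 h0
      rw [add_zero] at e0
      simp only [H 1 h1, e0]
      ring
    · have e0 := H 0 h0
      rw [add_zero] at e0
      simp only [H 1 h1, e0]
      ring
  · intro i s hs
    simp only
    rcases lt_or_ge i (2 * K) with hi | hi
    · have h' : (i + 1 : ℝ) ≤ 2 * K := by exact_mod_cast hi
      rw [hl0 _ h', hl0 _ (by linarith : (i : ℝ) ≤ 2 * K), hl0 _ (by linarith [hs.2])]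
      ring
    rcases lt_or_ge i (6 * K) with hi' | hi'
    · rcases hpiece i hi hi' with H | H
      · have e0 := H 0 h0
        rw [add_zero] at e0
        rw [H 1 h1, e0, H s hs]
        ring
      · have e0 := H 0 h0
        rw [add_zero] at e0
        rw [H 1 h1, e0, H s hs]
        ring
    · have h' : (6 * K : ℝ) ≤ i := by exact_mod_cast hi'
      rw [hh0 _ h', hh0 _ (by linarith : (6 * K : ℝ) ≤ i + 1), hh0 _ (by linarith [hs.1])]
      ring

/-- The point with coordinates `(x, y)` with respect to the orthonormal frame rotated by `θ`. -/
noncomputable def rotatedPoint (θ x y : ℝ) : Plane :=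
  !₂[x * Real.cos θ - y * Real.sin θ, x * Real.sin θ + y * Real.cos θ]

lemma dist_rotatedPoint (θ x y x' y' : ℝ) :
    dist (rotatedPoint θ x y) (rotatedPoint θ x' y') = √((x - x') ^ 2 + (y - y') ^ 2) := by
  rw [EuclideanSpace.dist_eq, rotatedPoint, rotatedPoint]
  simp only [Fin.sum_univ_two, Real.dist_eq, sq_abs]
  simp only [Matrix.cons_val_zero, Matrix.cons_val_one]
  congr 1
  linear_combination ((x - x') ^ 2 + (y - y') ^ 2) * Real.sin_sq_add_cos_sq θ

lemma rotatedPoint_zero_right (θ x : ℝ) : rotatedPoint θ x 0 = polarPoint x θ := by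
  simp [rotatedPoint, polarPoint]

lemma rotatedPoint_eq_polarPoint (θ : ℝ) {x : ℝ} (hx : 0 < x) (y : ℝ) :
    rotatedPoint θ x y = polarPoint √(x ^ 2 + y ^ 2) (θ + Real.arctan (y / x)) := by
  have hpos : 0 < √(x ^ 2 + y ^ 2) := Real.sqrt_pos.2 (by positivity)
  have h1 : √(1 + (y / x) ^ 2) = √(x ^ 2 + y ^ 2) / x := by
    rw [show 1 + (y / x) ^ 2 = (x ^ 2 + y ^ 2) / x ^ 2 by field_simp,
      Real.sqrt_div (by positivity), Real.sqrt_sq hx.le]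
  have hc : √(x ^ 2 + y ^ 2) * Real.cos (Real.arctan (y / x)) = x := by
    rw [Real.cos_arctan, h1]
    field_simp
  have hs : √(x ^ 2 + y ^ 2) * Real.sin (Real.arctan (y / x)) = y := by
    rw [Real.sin_arctan, h1]
    field_simp
  rw [polarPoint, rotatedPoint, Real.cos_add, Real.sin_add]
  congr 2
  · linear_combination (-Real.cos θ) * hc + Real.sin θ * hs
  · rw [show √(x ^ 2 + y ^ 2) * (Real.sin θ * Real.cos (Real.arctan (y / x)) +
        Real.cos θ * Real.sin (Real.arctan (y / x))) =
        Real.sin θ * (√(x ^ 2 + y ^ 2) * Real.cos (Real.arctan (y / x))) +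
        Real.cos θ * (√(x ^ 2 + y ^ 2) * Real.sin (Real.arctan (y / x))) by ring, hc, hs]
    rw [mul_comm x, mul_comm y]

lemma lineMap_rotatedPoint (θ x y x' y' s : ℝ) :
    AffineMap.lineMap (rotatedPoint θ x y) (rotatedPoint θ x' y') s =
      rotatedPoint θ ((1 - s) * x + s * x') ((1 - s) * y + s * y') := by
  rw [AffineMap.lineMap_apply_module]
  ext i
  fin_cases i
  · simp [rotatedPoint]
    ring
  · simp [rotatedPoint]
    ring

/-- The angle deviates from the axis by arctan (y / x), and y / x < δ < tan δ for the half-aperture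
δ. -/
lemma rotatedPoint_mem_sector {n : ℕ} {x y : ℝ} (hx : 0 < x) (hy : 0 ≤ y)
    (hxy : y < (1 / 2 : ℝ) ^ (n + 2) * x) (hr : x ^ 2 + y ^ 2 < ((1 / 2 : ℝ) ^ n) ^ 2) :
    rotatedPoint ((1 / 2 : ℝ) ^ n) x y ∈ sector n := by
  have hδ : (0 : ℝ) < (1 / 2) ^ (n + 2) := by positivity
  have hδ1 : (1 / 2 : ℝ) ^ (n + 2) ≤ 1 := pow_le_one₀ (by norm_num) (by norm_num)
  have hδ2 : (1 / 2 : ℝ) ^ (n + 2) < Real.pi / 2 := by linarith [Real.pi_gt_three]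
  have h0 : 0 ≤ Real.arctan (y / x) := Real.arctan_nonneg.2 (by positivity)
  have h1 : Real.arctan (y / x) < (1 / 2) ^ (n + 2) := by
    have h2 : y / x < Real.tan ((1 / 2) ^ (n + 2)) :=
      ((div_lt_iff₀ hx).2 hxy).trans (Real.lt_tan hδ hδ2)
    have h3 := Real.arctan_strictMono h2
    rwa [Real.arctan_tan (by linarith) hδ2] at h3
  exact ⟨_, _, Real.sqrt_nonneg _, (Real.sqrt_lt' (by positivity)).2 hr, by linarith, by linarith,
    rotatedPoint_eq_polarPoint _ hx y⟩

lemma sum_zigzag {K : ℕ} {G : ℝ → ℝ} {h c : ℝ} (hc : 0 ≤ c)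
    (hlow : ∀ q : ℝ, q ≤ 2 * K → G q = 0) (hhigh : ∀ q : ℝ, 6 * K ≤ q → G q = 0)
    (hstep : ∀ i : ℕ, 2 * K ≤ i → i < 6 * K → (G (i + 1) - G i) ^ 2 = h ^ 2) :
    ∑ i ∈ Finset.range (8 * K), √(c ^ 2 + (G (i + 1) - G i) ^ 2) =
      4 * K * c + 4 * K * √(c ^ 2 + h ^ 2) := by
  rw [show 8 * K = 2 * K + 4 * K + 2 * K by ring, Finset.sum_range_add, Finset.sum_range_add]
  have h1 : ∀ i ∈ Finset.range (2 * K), √(c ^ 2 + (G (i + 1) - G i) ^ 2) = c := by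
    intro i hi
    have : (i + 1 : ℝ) ≤ 2 * K := by exact_mod_cast Finset.mem_range.1 hi
    rw [hlow _ this, hlow _ (by linarith), sub_zero, zero_pow two_ne_zero, add_zero,
      Real.sqrt_sq hc]
  have h2 : ∀ i ∈ Finset.range (4 * K),
      √(c ^ 2 + (G ((2 * K + i : ℕ) + 1) - G (2 * K + i : ℕ)) ^ 2) = √(c ^ 2 + h ^ 2) := by
    intro i hi
    have := Finset.mem_range.1 hi
    rw [hstep _ (by omega) (by omega)]
  have h3 : ∀ i ∈ Finset.range (2 * K),
      √(c ^ 2 + (G ((2 * K + 4 * K + i : ℕ) + 1) - G (2 * K + 4 * K + i : ℕ)) ^ 2) = c := by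
    intro i _
    have : (6 * K : ℝ) ≤ (2 * K + 4 * K + i : ℕ) := by
      push_cast
      linarith [(Nat.cast_nonneg i : (0 : ℝ) ≤ i)]
    rw [hhigh _ this, hhigh _ (by linarith), sub_zero, zero_pow two_ne_zero, add_zero,
      Real.sqrt_sq hc]
  rw [Finset.sum_congr rfl h1, Finset.sum_congr rfl h2, Finset.sum_congr rfl h3]
  simp only [Finset.sum_const, Finset.card_range, nsmul_eq_mul]
  push_cast
  ring

/-- The arm is the graph of a zigzag over the segment to the tip, flat on the first and last
quarters. The oscillation stays away from the vertex, where the sector is narrow. -/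
lemma exists_arm (n : ℕ) :
    ∃ A : Set Plane, IsPolygonalArc A 0 (tipPoint n) (2 ^ n) ∧ A ⊆ sector n ∪ {tipPoint n} := by
  set R : ℝ := (1 / 2) ^ n with hR
  set l : ℝ := 2 ^ n with hl
  set δ : ℝ := (1 / 2) ^ (n + 2) with hδ
  have hR0 : 0 < R := by positivity
  have hR1 : R ≤ 1 := pow_le_one₀ (by norm_num) (by norm_num)
  have hl1 : 1 ≤ l := one_le_pow₀ (by norm_num)
  have hδ0 : 0 < δ := by positivity
  have hδ1 : δ ≤ 1 := pow_le_one₀ (by norm_num) (by norm_num)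
  -- `K` is large enough to force the height below `δ * (R / 4)`, the room in the sector at abscissa
  -- `R / 4`.
  obtain ⟨K, hK⟩ := exists_nat_gt (l / (R * δ))
  have hKpos : (0 : ℝ) < K := lt_of_le_of_lt (by positivity) hK
  have hK' : l < K * (R * δ) := (div_lt_iff₀ (by positivity)).1 hK
  -- Solves R/2 + √((R/2)² + (4Kh)²) = l: the flat pieces have total length R/2, and 4K oblique ones
  -- supply the rest.
  set h : ℝ := √(l ^ 2 - l * R) / (4 * K) with hh
  have hrad : 0 ≤ l ^ 2 - l * R := by nlinarith
  have hh0 : 0 ≤ h := by positivity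
  have hhsq : (4 * K * h) ^ 2 = l ^ 2 - l * R := by
    rw [hh, mul_div_cancel₀ _ (by positivity), Real.sq_sqrt hrad]
  have hhlt : h < δ * (R / 4) := by
    rw [hh, div_lt_iff₀ (by positivity)]
    have : √(l ^ 2 - l * R) ≤ l := Real.sqrt_le_iff.2 ⟨by linarith, by nlinarith⟩
    linarith
  obtain ⟨G, hGc, hGm, hGlow, hGhigh, hGstep, hGaff⟩ := exists_zigzag K hh0
  set e : ℝ → Plane := fun s => rotatedPoint R (R * s) (G (8 * K * s)) with he
  set t : ℕ → ℝ := fun i => i / (8 * K) with ht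
  have hGt : ∀ i : ℕ, G (8 * K * t i) = G i := fun i => by
    simp only [ht]
    rw [mul_div_cancel₀ _ (by positivity)]
  have ht0 : t 0 = 0 := by simp [ht]
  have ht1 : t (8 * K) = 1 := by
    simp only [ht]
    push_cast
    exact div_self (by positivity)
  have htlt : ∀ i, t i < t (i + 1) := fun i => by
    simp only [ht]
    push_cast
    gcongr
    linarith
  have haff : ∀ i, ∀ s ∈ Icc (0 : ℝ) 1, e (AffineMap.lineMap (t i) (t (i + 1)) s) =
      AffineMap.lineMap (e (t i)) (e (t (i + 1))) s := by
    intro i s hs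
    have h1 : (AffineMap.lineMap (t i) (t (i + 1)) s : ℝ) = (i + s) / (8 * K) := by
      rw [AffineMap.lineMap_apply_ring']
      simp only [ht]
      push_cast
      ring
    have h2 : G (8 * K * ((i + s) / (8 * K))) = (1 - s) * G i + s * G (i + 1) := by
      rw [mul_div_cancel₀ _ (by positivity), hGaff i s hs]
    have h3 := hGt (i + 1)
    push_cast at h3
    simp only [he]
    rw [lineMap_rotatedPoint, h1, h2, hGt, h3]
    congr 1
    simp only [ht]
    push_cast
    ring
  have he0 : e 0 = 0 := by
    simp only [he]
    rw [mul_zero, mul_zero, hGlow 0 (by positivity), rotatedPoint_zero_right, ← norm_eq_zero,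
      norm_polarPoint le_rfl]
  have he1 : e 1 = tipPoint n := by
    simp only [he]
    rw [mul_one, mul_one, hGhigh _ (by linarith), rotatedPoint_zero_right, tipPoint]
  have hmap : ∀ s ∈ Icc (0 : ℝ) 1, e s ∈ sector n ∪ {tipPoint n} := by
    intro s hs
    rcases hs.1.eq_or_lt with h0 | h0
    · left
      rw [← h0, he0]
      have : (1 / 2 : ℝ) ^ (n + 2) = δ := rfl
      refine ⟨0, R, le_rfl, hR0, by linarith, by linarith, ?_⟩
      rw [eq_comm, ← norm_eq_zero, norm_polarPoint le_rfl]
    rcases hs.2.eq_or_lt with h1 | h1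
    · right
      rw [h1]
      exact he1
    left
    have hx : 0 < R * s := by positivity
    have hxR : R * s < R := by nlinarith
    have hG := hGm (8 * K * s)
    have hzero : G (8 * K * s) = 0 → e s ∈ sector n := by
      intro hG0
      refine rotatedPoint_mem_sector hx hG.1 ?_ ?_
      · rw [hG0]
        positivity
      · rw [hG0, zero_pow two_ne_zero, add_zero]
        exact pow_lt_pow_left₀ hxR hx.le two_ne_zero
    rcases le_total s (1 / 4) with h2 | h2
    · exact hzero (hGlow _ (by nlinarith))
    rcases le_total (3 / 4) s with h3 | h3
    · exact hzero (hGhigh _ (by nlinarith))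
    have hlt : G (8 * K * s) < δ * (R / 4) := hG.2.trans_lt hhlt
    refine rotatedPoint_mem_sector hx hG.1 (hlt.trans_le ?_) ?_
    · exact mul_le_mul_of_nonneg_left (by nlinarith) hδ0.le
    · have h4 : G (8 * K * s) ≤ R / 4 := hlt.le.trans (by nlinarith)
      have h5 : (R * s) ^ 2 ≤ (R * (3 / 4)) ^ 2 :=
        pow_le_pow_left₀ hx.le (mul_le_mul_of_nonneg_left h3 hR0.le) 2
      have h6 : G (8 * K * s) ^ 2 ≤ (R / 4) ^ 2 := pow_le_pow_left₀ hG.1 h4 2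
      change _ < R ^ 2
      nlinarith [pow_pos hR0 2]
  have hlen : eVariationOn e (Icc 0 1) = 2 ^ n := by
    have hmono : Monotone t := monotone_nat_of_le_succ fun i => (htlt i).le
    have h1 := eVariationOn.sum' e hmono (n := 8 * K)
    rw [ht0, ht1] at h1
    have h2 : ∀ i ∈ Finset.range (8 * K), eVariationOn e (Icc (t i) (t (i + 1))) =
        ENNReal.ofReal √((R / (8 * K)) ^ 2 + (G (i + 1) - G i) ^ 2) := by
      intro i _
      have h3 := hGt (i + 1)
      push_cast at h3
      rw [eVariationOn_Icc_of_affine (htlt i) (haff i), edist_dist]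
      simp only [he]
      rw [dist_rotatedPoint, hGt, h3]
      congr 2
      simp only [ht]
      push_cast
      ring
    rw [← h1, Finset.sum_congr rfl h2, ← ENNReal.ofReal_sum_of_nonneg fun i _ => Real.sqrt_nonneg _,
      sum_zigzag (by positivity) hGlow hGhigh hGstep]
    have h4 : 4 * K * √((R / (8 * K)) ^ 2 + h ^ 2) = l - R / 2 := by
      have h5 : (4 * K : ℝ) = √((4 * K) ^ 2) := (Real.sqrt_sq (by positivity)).symm
      rw [h5, ← Real.sqrt_mul (by positivity),
        show (4 * K : ℝ) ^ 2 * ((R / (8 * K)) ^ 2 + h ^ 2) = (R / 2) ^ 2 + (4 * K * h) ^ 2 by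
          field_simp
          ring,
        hhsq, show (R / 2) ^ 2 + (l ^ 2 - l * R) = (l - R / 2) ^ 2 by ring,
        Real.sqrt_sq (by linarith)]
    have h6 : 4 * K * (R / (8 * K)) = R / 2 := by
      field_simp
      norm_num
    rw [h4, h6, show R / 2 + (l - R / 2) = l by ring, hl, ENNReal.ofReal_pow (by norm_num)]
    simp
  refine ⟨e '' Icc 0 1, ⟨e, ?_, ?_, rfl, he0, he1,
    ⟨8 * K, t, ht0, ht1, fun i _ => htlt i, fun i _ => haff i⟩, hlen⟩, ?_⟩
  · have hec : Continuous e := by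
      simp only [he]
      unfold rotatedPoint
      fun_prop
    exact hec.continuousOn
  -- The coordinate `R * s` along the axis already separates parameters.
  · intro s _ s' _ hss
    have h1 : dist (e s) (e s') = 0 := by rw [hss, dist_self]
    simp only [he] at h1
    rw [dist_rotatedPoint, Real.sqrt_eq_zero (by positivity)] at h1
    have h2 : (R * s - R * s') ^ 2 = 0 :=
      le_antisymm (by nlinarith [sq_nonneg (G (8 * K * s) - G (8 * K * s'))]) (sq_nonneg _)
    have h3 := pow_eq_zero_iff two_ne_zero |>.1 h2
    exact mul_left_cancel₀ hR0.ne' (sub_eq_zero.1 h3)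
  · rintro _ ⟨s, hs, rfl⟩
    exact hmap s hs

lemma exists_isArmFamily : ∃ L : ℕ → Set Plane, IsArmFamily L := by
  choose L hL using exists_arm
  exact ⟨L, fun n _ => hL n⟩

theorem mainTheorem5 :
    (∃ L : ℕ → Set Plane, IsArmFamily L) ∧
    ∀ L : ℕ → Set Plane, IsArmFamily L →
      IsDendrite (armUnion L) ∧
      IsBanachFractal (armUnion L) ∧
      ¬ IsWeakIFSAttractor (armUnion L) ∧
      ∀ (X : Type u) [MetricSpace X] (ι : armUnion L → X), Isometry ι →
        ¬ IsWeakIFSAttractor (Set.range ι) := by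
  refine ⟨exists_isArmFamily, fun L hL => ?_⟩
  obtain ⟨E, hE, hP, hlen, hend⟩ := hL.exists_isArmSystem
  have hmono : StrictMono fun n => eVariationOn (E n) (Icc 0 1) := by
    simpa only [hlen] using strictMono_two_pow_succ
  rw [hP]
  refine ⟨hE.isDendrite, hE.isBanachFractal, ?_,
    fun X _ ι hι => hE.not_isWeakIFSAttractor_range hmono hend ι hι⟩
  have := hE.not_isWeakIFSAttractor_range hmono hend Subtype.val isometry_subtype_coe
  rwa [Subtype.range_coe] at this
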